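/- Let $G=(V,E)$ be a finite connected simple graph with a vertex measure $\mu:V\to(0,\infty)$ and positive symmetric edge weights $w_{xy}=w_{yx}>0$, $xy\in E$, and let $$\Delta u(x)=\frac1{\mu(x)}\sum_{y\sim x}w_{xy}\,(u(y)-u(x))$$ be the Laplacian of a function $u:V\to\mathbb R$. Let $h_1,h_2:V\to(0,\infty)$ be two functions and $A,B>0$ two constants. On the space $L^\infty(V)$ of all functions $u:V\to\mathbb R$, with the norm $\|u\|_\infty=\max_V|u|$, consider the map $$\mathcal G_{h_1,h_2}(u)=-\Delta u+h_1e^{Au}(e^{Au}-1)+h_2e^{-Bu}(e^{-Bu}-1),$$ and let $B_R=\{u\in L^\infty(V):\|u\|_\infty<R\}$. Then there is a constant $L$ such that for every $R>L$ the Brouwer degree $\deg(\mathcal G_{h_1,h_2},B_R,0)$ is well defined (that is, $\mathcal G_{h_1,h_2}$ has no zero on $\partial B_R$) and $$\deg(\mathcal G_{h_1,h_2},B_R,0)=0 .$$ In particular $\lim_{R\to+\infty}\deg(\mathcal G_{h_1,h_2},B_R,0)=0$. -/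

import Mathlib

open scoped ContDiff

noncomputable section

section Degree

variable {ι : Type*} [Fintype ι]

/-- `p` is a regular value of `g` on `Ω`: the derivative of `g` is invertible at every point of `Ω`
that `g` sends to `p`. -/
def IsRegularValueOn (g : (ι → ℝ) → (ι → ℝ)) (Ω : Set (ι → ℝ)) (p : ι → ℝ) : Prop :=
  ∀ x ∈ Ω, g x = p → (fderiv ℝ g x).det ≠ 0

/-- The signed count `∑_{x ∈ Ω, g x = p} sgn det Dg(x)`. When `Ω` is bounded, `g` is smooth,
`p ∉ g (∂Ω)` and `p` is a regular value of `g` on `Ω`, this is a finite sum. -/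
def signedCount (g : (ι → ℝ) → (ι → ℝ)) (Ω : Set (ι → ℝ)) (p : ι → ℝ) : ℤ :=
  ∑ᶠ x ∈ {x | x ∈ Ω ∧ g x = p}, (SignType.sign (fderiv ℝ g x).det : ℤ)

/-- `g` is a smooth map that is uniformly closer to `f` on the closure of `Ω` than `p` is to
`f (∂Ω)`, and `p` is a regular value of `g` on `Ω`. -/
structure IsRegularApprox (f : (ι → ℝ) → (ι → ℝ)) (Ω : Set (ι → ℝ)) (p : ι → ℝ)
    (g : (ι → ℝ) → (ι → ℝ)) : Prop where
  smooth : ContDiff ℝ ∞ g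
  close : ∀ x ∈ closure Ω, ∀ y ∈ frontier Ω, dist (g x) (f x) < dist p (f y)
  regular : IsRegularValueOn g Ω p

/-- The Brouwer degree `deg(f, Ω, p)` is well defined and equals `d`: the set `Ω` is bounded and
open, `f` is continuous on the closure of `Ω`, `p ∉ f (∂Ω)`, and `d` is the common value of the
signed counts of the regular smooth approximations of `f`, of which there is at least one. -/
structure HasBrouwerDegree (f : (ι → ℝ) → (ι → ℝ)) (Ω : Set (ι → ℝ)) (p : ι → ℝ)
    (d : ℤ) : Prop where
  isOpen : IsOpen Ω
  isBounded : Bornology.IsBounded Ω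
  continuousOn : ContinuousOn f (closure Ω)
  notMem : p ∉ f '' frontier Ω
  exists_approx : ∃ g, IsRegularApprox f Ω p g
  count_eq : ∀ g, IsRegularApprox f Ω p g → signedCount g Ω p = d

theorem HasBrouwerDegree.unique {f : (ι → ℝ) → (ι → ℝ)} {Ω : Set (ι → ℝ)} {p : ι → ℝ}
    {d d' : ℤ}
    (h : HasBrouwerDegree f Ω p d) (h' : HasBrouwerDegree f Ω p d') : d = d' := by
  obtain ⟨g, hg⟩ := h.exists_approx
  rw [← h.count_eq g hg, h'.count_eq g hg]

end Degree

section Graph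

variable {V : Type*} [Fintype V] (G : SimpleGraph V) [DecidableRel G.Adj]

/-- The Laplacian of the graph `G` with vertex measure `μ` and edge weights `w`. -/
def graphLaplacian (μ : V → ℝ) (w : V → V → ℝ) (u : V → ℝ) (x : V) : ℝ :=
  (1 / μ x) * ∑ y ∈ G.neighborFinset x, w x y * (u y - u x)

/-- The map `u ↦ -Δu + h₁ e^{Au} (e^{Au} - 1) + h₂ e^{-Bu} (e^{-Bu} - 1)`. Functions on `V` carry
the maximum norm. -/
def tzitzeicaMap (μ : V → ℝ) (w : V → V → ℝ) (h₁ h₂ : V → ℝ) (A B : ℝ) (u : V → ℝ) : V → ℝ :=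
  fun x => -graphLaplacian G μ w u x
    + h₁ x * Real.exp (A * u x) * (Real.exp (A * u x) - 1)
    + h₂ x * Real.exp (-B * u x) * (Real.exp (-B * u x) - 1)

end Graph

end

/-!
If `p` is not in the convex hull of `f (∂Ω)`, the straight-line homotopy from `f` to a constant map
at a point of `f (∂Ω)` avoids `p` on `∂Ω`, so the degree of `f` at `p` is that of a constant map,
namely `0`. The homotopy invariance comes from Heinz's integral `∫_Ω φ(g) det Dg`, with `φ` a bump
at `p`: by the change of variables formula it is `∫ φ` times the signed count of the regular
zeros of `g - p`, and it is constant along the homotopy by Stokes' theorem on the cylinder over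
`Ω`, because the pullback of the top-degree form `φ dx₁ ∧ ⋯ ∧ dxₙ` is closed.

For the Tzitzeica map, `Δu` has zero `μ`-sum and `exp t * (exp t - 1) ≥ max t (-1/4)`, so the
`μ`-sum of the image of `u` grows at least linearly in `‖u‖`. Hence the image of a large sphere lies
in an open half-space whose boundary passes through `0`.
-/

noncomputable section

open Filter Function MeasureTheory Metric Set Topology

section TopDegreePullback

variable {n : ℕ} {E F : Type*} [NormedAddCommGroup E] [NormedSpace ℝ E] [NormedAddCommGroup F]
  [NormedSpace ℝ F]

theorem alternatingMap_eq_zero_of_finrank_lt [FiniteDimensional ℝ F]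
    (h : Module.finrank ℝ F < n) (β : F [⋀^Fin n]→L[ℝ] ℝ) : β = 0 := by
  ext v
  refine β.toAlternatingMap.map_linearDependent v fun hv => h.not_ge ?_
  simpa using hv.fintype_card_le_finrank

/-- The pullback `f^* α` of a differential form `α` under the map `f`. -/
def pullbackForm (α : F → F [⋀^Fin n]→L[ℝ] ℝ) (f : E → F) (z : E) : E [⋀^Fin n]→L[ℝ] ℝ :=
  (α (f z)).compContinuousLinearMap (fderiv ℝ f z)

variable {α : F → F [⋀^Fin n]→L[ℝ] ℝ} {f : E → F}

theorem differentiable_pullbackForm (hα : Differentiable ℝ α) (hf : ContDiff ℝ 2 f) :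
    Differentiable ℝ (pullbackForm α f) := fun z =>
  ((hα.comp (hf.differentiable two_ne_zero)) z).continuousAlternatingMapCompContinuousLinearMap
    ((hf.fderiv_right (m := 1) one_add_one_eq_two.le).differentiable one_ne_zero z)

theorem extDeriv_pullbackForm_of_finrank_le [FiniteDimensional ℝ F]
    (h : Module.finrank ℝ F ≤ n) (hα : Differentiable ℝ α) (hf : ContDiff ℝ 2 f) (z : E) :
    extDeriv (pullbackForm α f) z = 0 := by
  unfold pullbackForm
  rw [extDeriv_pullback (hα _) (hf.contDiffAt (x := z)) (by simp),
    alternatingMap_eq_zero_of_finrank_lt (Nat.lt_succ_of_le h) (extDeriv α (f z))]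
  rfl

theorem pullbackForm_eventuallyEq_zero {z : E} (hf : ContinuousAt f z)
    (hz : f z ∉ tsupport α) : pullbackForm α f =ᶠ[𝓝 z] 0 := by
  filter_upwards [hf.eventually (notMem_tsupport_iff_eventuallyEq.1 hz)] with y hy
  rw [pullbackForm, hy]
  rfl

end TopDegreePullback

section Stokes

variable {n : ℕ} {η : (Fin (n + 1) → ℝ) → (Fin (n + 1) → ℝ) [⋀^Fin n]→L[ℝ] ℝ}

theorem integral_Icc_extDeriv {a b : Fin (n + 1) → ℝ} (hab : a ≤ b)
    (hη : ∀ z ∈ Icc a b, DifferentiableAt ℝ η z)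
    (hint : IntegrableOn (fun z => extDeriv η z (Pi.single · 1)) (Icc a b)) :
    ∫ z in Icc a b, extDeriv η z (Pi.single · 1) =
      ∑ i : Fin (n + 1), (-1) ^ (i : ℕ) *
        ((∫ x in Icc (a ∘ i.succAbove) (b ∘ i.succAbove),
            η (i.insertNth (b i) x) fun j => Pi.single (i.succAbove j) 1) -
          ∫ x in Icc (a ∘ i.succAbove) (b ∘ i.succAbove),
            η (i.insertNth (a i) x) fun j => Pi.single (i.succAbove j) 1) := by
  let f (i : Fin (n + 1)) (z : Fin (n + 1) → ℝ) : ℝ :=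
    (-1) ^ (i : ℕ) * η z fun j => Pi.single (i.succAbove j) 1
  have hcoeff (i : Fin (n + 1)) (z) (hz : z ∈ Icc a b) :
      DifferentiableAt ℝ (fun z => η z fun j => Pi.single (i.succAbove j) 1) z :=
    (hη z hz).continuousAlternatingMap_apply_const _
  have hf (i : Fin (n + 1)) (z) (hz : z ∈ Icc a b) : DifferentiableAt ℝ (f i) z :=
    (hcoeff i z hz).const_mul _
  have hdiv : EqOn (fun z => extDeriv η z (Pi.single · 1))
      (fun z => ∑ i, fderiv ℝ (f i) z (Pi.single i 1)) (Icc a b) := by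
    intro z hz
    simp only [extDeriv_apply (hη z hz), f]
    refine Finset.sum_congr rfl fun i _ => ?_
    rw [fderiv_const_mul (hcoeff i z hz), smul_apply, zsmul_eq_mul, smul_eq_mul]
    push_cast
    rfl
  rw [setIntegral_congr_fun measurableSet_Icc hdiv,
    integral_divergence_of_hasFDerivAt_off_countable' a b hab f (fun i z => fderiv ℝ (f i) z) ∅
      countable_empty (fun i z hz => (hf i z hz).continuousAt.continuousWithinAt)
      (fun z hz i => (hf i z ?_).hasFDerivAt) (hint.congr_fun hdiv measurableSet_Icc)]
  · simp only [f, integral_const_mul, mul_sub]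
  · rw [← pi_univ_Icc]
    exact fun i hi => Ioo_subset_Icc_self (hz.1 i hi)

theorem integral_Icc_cons_eq_of_extDeriv_eq_zero {s t : ℝ} {a b : Fin n → ℝ} (hst : s ≤ t)
    (hab : a ≤ b)
    (hη : ∀ z ∈ Icc (Fin.cons s a : Fin (n + 1) → ℝ) (Fin.cons t b), DifferentiableAt ℝ η z)
    (hclosed : ∀ z ∈ Icc (Fin.cons s a : Fin (n + 1) → ℝ) (Fin.cons t b), extDeriv η z = 0)
    (hside : ∀ z j, z (Fin.succ j) = a j ∨ z (Fin.succ j) = b j → η z = 0) :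
    ∫ x in Icc a b, η (Fin.cons s x) (fun j => Pi.single j.succ 1) =
      ∫ x in Icc a b, η (Fin.cons t x) (fun j => Pi.single j.succ 1) := by
  have hzero : EqOn (fun z => extDeriv η z (Pi.single · 1)) 0
      (Icc (Fin.cons s a : Fin (n + 1) → ℝ) (Fin.cons t b)) := fun z hz => by
    simp [hclosed z hz]
  have hstokes := integral_Icc_extDeriv (Fin.cons_le_cons.2 ⟨hst, hab⟩) hη
    (integrableOn_zero.congr_fun hzero.symm measurableSet_Icc)
  rw [setIntegral_congr_fun measurableSet_Icc hzero, Fin.sum_univ_succ,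
    Finset.sum_eq_zero fun j _ => ?_] at hstokes
  · simp only [Pi.zero_apply, integral_zero, Fin.val_zero, pow_zero, one_mul, Fin.insertNth_zero',
      Fin.succAbove_zero, Fin.cons_zero, Fin.cons_comp_succ, add_zero] at hstokes
    exact (sub_eq_zero.1 hstokes.symm).symm
  · have hback (x) : η (j.succ.insertNth (a j) x) = 0 := hside _ j (by simp)
    have hfront (x) : η (j.succ.insertNth (b j) x) = 0 := hside _ j (by simp)
    simp [hback, hfront]

end Stokes

section Cylinder

theorem indicator_eventuallyEq_self_or_zero {X M : Type*} [TopologicalSpace X] [Zero M]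
    {U : Set X} {η : X → M} {z : X} (hU : IsOpen U) (hz : z ∈ frontier U → η =ᶠ[𝓝 z] 0) :
    U.indicator η =ᶠ[𝓝 z] η ∨ U.indicator η =ᶠ[𝓝 z] 0 := by
  by_cases hzU : z ∈ U
  · exact .inl <| eventuallyEq_of_mem (hU.mem_nhds hzU) (eqOn_indicator (s := U))
  refine .inr ?_
  by_cases hcl : z ∈ closure U
  · filter_upwards [hz (hU.frontier_eq ▸ ⟨hcl, hzU⟩)] with y hy
    exact indicator_apply_eq_zero.2 fun _ => hy
  · filter_upwards [isClosed_closure.isOpen_compl.mem_nhds hcl] with y hy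
    exact indicator_of_notMem (fun h => hy (subset_closure h)) η

variable {n : ℕ} {η : (Fin (n + 1) → ℝ) → (Fin (n + 1) → ℝ) [⋀^Fin n]→L[ℝ] ℝ}
  {Ω : Set (Fin n → ℝ)}

theorem integral_Icc_indicator_preimage_tail {a b : Fin n → ℝ} (hΩ : MeasurableSet Ω)
    (hsub : Ω ⊆ Icc a b) (r : ℝ) :
    ∫ x in Icc a b, (Fin.tail ⁻¹' Ω).indicator η (Fin.cons r x) (fun j => Pi.single j.succ 1) =
      ∫ x in Ω, η (Fin.cons r x) (fun j => Pi.single j.succ 1) := by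
  have hslice : (fun x => (Fin.tail ⁻¹' Ω).indicator η (Fin.cons r x)
      fun j => Pi.single j.succ 1) =
      Ω.indicator fun x => η (Fin.cons r x) fun j => Pi.single j.succ 1 := by
    ext x
    by_cases hx : x ∈ Ω <;> simp [hx]
  rw [hslice, setIntegral_indicator hΩ, inter_eq_right.2 hsub]

theorem setIntegral_cons_eq_of_extDeriv_eq_zero {s t : ℝ} (hst : s ≤ t) (hΩ : IsOpen Ω)
    (hb : Bornology.IsBounded Ω) (hη : Differentiable ℝ η) (hclosed : ∀ z, extDeriv η z = 0)
    (hlat : ∀ r ∈ Icc s t, ∀ x ∈ frontier Ω, η =ᶠ[𝓝 (Fin.cons r x)] 0) :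
    ∫ x in Ω, η (Fin.cons s x) (fun j => Pi.single j.succ 1) =
      ∫ x in Ω, η (Fin.cons t x) (fun j => Pi.single j.succ 1) := by
  obtain ⟨R, hR, hball⟩ := hb.subset_ball_lt 0 0
  have hΩR (x) (hx : x ∈ Ω) (j : Fin n) : -R < x j ∧ x j < R :=
    abs_lt.1 <| (norm_le_pi_norm x j).trans_lt (mem_ball_zero_iff.1 (hball hx))
  have hsub : Ω ⊆ Icc (fun _ => -R) fun _ => R := fun x hx =>
    ⟨fun j => (hΩR x hx j).1.le, fun j => (hΩR x hx j).2.le⟩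
  let C : Set (Fin (n + 1) → ℝ) := Fin.tail ⁻¹' Ω
  have htail : Continuous (Fin.tail : (Fin (n + 1) → ℝ) → Fin n → ℝ) := continuous_id.finTail
  have hloc (z) (hz : z ∈ Icc (Fin.cons s fun _ => -R : Fin (n + 1) → ℝ)
      (Fin.cons t fun _ => R)) :
      C.indicator η =ᶠ[𝓝 z] η ∨ C.indicator η =ᶠ[𝓝 z] 0 :=
    indicator_eventuallyEq_self_or_zero (hΩ.preimage htail) fun hzC => by
      simpa using hlat (z 0) ⟨hz.1 0, hz.2 0⟩ _ (htail.frontier_preimage_subset Ω hzC)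
  rw [← integral_Icc_indicator_preimage_tail hΩ.measurableSet hsub,
    ← integral_Icc_indicator_preimage_tail hΩ.measurableSet hsub]
  refine integral_Icc_cons_eq_of_extDeriv_eq_zero hst (fun _ => by simp [hR.le])
    (fun z hz => ?_) (fun z hz => ?_) fun z j hj => indicator_of_notMem (fun hz => ?_) _
  · rcases hloc z hz with h | h
    · exact h.differentiableAt_iff.2 (hη z)
    · exact h.differentiableAt_iff.2 (differentiableAt_const 0)
  · rcases hloc z hz with h | h
    · rw [h.extDeriv_eq, hclosed]
    · rw [extDeriv, h.fderiv_eq, fderiv_zero]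
      ext v
      simp [ContinuousAlternatingMap.alternatizeUncurryFin_apply]
  · have := hΩR _ hz j
    rcases hj with h | h <;> simp_all [Fin.tail]

end Cylinder

section HeinzIntegral

/-- Heinz's integral `∫_Ω φ(g) det Dg`: for `φ` of total mass `1` supported near a point off
`g (∂Ω)`, it computes the Brouwer degree of `g` on `Ω` at that point. -/
def heinzIntegral {E : Type*} [NormedAddCommGroup E] [NormedSpace ℝ E] [MeasureSpace E]
    (φ : E → ℝ) (g : E → E) (Ω : Set E) : ℝ :=
  ∫ x in Ω, φ (g x) * (fderiv ℝ g x).det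

/-- The standard volume form `dx₁ ∧ ⋯ ∧ dxₙ`, as a continuous alternating map. -/
def volForm (n : ℕ) : (Fin n → ℝ) [⋀^Fin n]→L[ℝ] ℝ where
  toMultilinearMap := Matrix.detRowAlternating.toMultilinearMap
  cont := Continuous.matrix_det (continuous_id (X := Matrix (Fin n) (Fin n) ℝ))
  map_eq_zero_of_eq' := Matrix.detRowAlternating.map_eq_zero_of_eq'

/-- The straight-line homotopy from `g` to `k`, with the time variable as zeroth coordinate. -/
def lineHomotopy {n : ℕ} (g k : (Fin n → ℝ) → Fin n → ℝ) (z : Fin (n + 1) → ℝ) : Fin n → ℝ :=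
  (1 - z 0) • g (Fin.tail z) + z 0 • k (Fin.tail z)

variable {n : ℕ}

theorem volForm_comp_single (L : (Fin n → ℝ) →L[ℝ] (Fin n → ℝ)) :
    volForm n (fun j => L (Pi.single j 1)) = L.det := by
  have h := (Pi.basisFun ℝ (Fin n)).det_comp (L : (Fin n → ℝ) →ₗ[ℝ] (Fin n → ℝ))
    (Pi.basisFun ℝ (Fin n))
  rw [Module.Basis.det_self, mul_one, Pi.basisFun_det] at h
  have hcol : (fun j => L (Pi.single j 1)) = L ∘ Pi.basisFun ℝ (Fin n) := by
    ext
    simp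
  rw [ContinuousLinearMap.det, ← h, hcol]
  rfl

theorem pullbackForm_smul_volForm_cons {φ : (Fin n → ℝ) → ℝ} {F : (Fin (n + 1) → ℝ) → Fin n → ℝ}
    (hF : Differentiable ℝ F) (s : ℝ) (x : Fin n → ℝ) :
    pullbackForm (fun y => φ y • volForm n) F (Fin.cons s x) (fun j => Pi.single j.succ 1) =
      φ (F (Fin.cons s x)) * (fderiv ℝ (fun y => F (Fin.cons s y)) x).det := by
  let incl : (Fin n → ℝ) →L[ℝ] Fin (n + 1) → ℝ := ContinuousLinearMap.finCons 0 (.id ℝ _)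
  have hcol (j : Fin n) : incl (Pi.single j 1) = Pi.single j.succ 1 := by
    ext i
    refine Fin.cases ?_ (fun k => ?_) i <;> simp [incl, Pi.single_apply]
  have hcons : HasFDerivAt (fun y : Fin n → ℝ => (Fin.cons s y : Fin (n + 1) → ℝ)) incl x :=
    (hasFDerivAt_const s x).finCons (hasFDerivAt_id x)
  have hslice := ((hF (Fin.cons s x)).hasFDerivAt.comp x hcons).fderiv
  change fderiv ℝ (fun y => F (Fin.cons s y)) x = _ at hslice
  rw [hslice, ← volForm_comp_single]
  simp only [ContinuousLinearMap.comp_apply, hcol]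
  rfl

theorem contDiff_lineHomotopy {g k : (Fin n → ℝ) → Fin n → ℝ} {r : WithTop ℕ∞}
    (hg : ContDiff ℝ r g) (hk : ContDiff ℝ r k) : ContDiff ℝ r (lineHomotopy g k) := by
  have htail : ContDiff ℝ r (Fin.tail : (Fin (n + 1) → ℝ) → Fin n → ℝ) := by
    unfold Fin.tail; fun_prop
  have h0 : ContDiff ℝ r fun (z : Fin (n + 1) → ℝ) => z 0 := by fun_prop
  exact ((contDiff_const.sub h0).smul (hg.comp htail)).add (h0.smul (hk.comp htail))

theorem heinzIntegral_eq_of_homotopy_fin {g k : (Fin n → ℝ) → Fin n → ℝ} {φ : (Fin n → ℝ) → ℝ}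
    {Ω : Set (Fin n → ℝ)} (hΩ : IsOpen Ω) (hb : Bornology.IsBounded Ω) (hg : ContDiff ℝ 2 g)
    (hk : ContDiff ℝ 2 k) (hφ : Differentiable ℝ φ)
    (hfr : ∀ x ∈ frontier Ω, Disjoint (segment ℝ (g x) (k x)) (tsupport φ)) :
    heinzIntegral φ g Ω = heinzIntegral φ k Ω := by
  have hF := contDiff_lineHomotopy hg hk
  have hα : Differentiable ℝ fun y => φ y • volForm n := hφ.smul_const _
  have hsupp : tsupport (fun y => φ y • volForm n) ⊆ tsupport φ :=
    closure_mono (Function.support_smul_subset_left φ _)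
  have h := setIntegral_cons_eq_of_extDeriv_eq_zero zero_le_one hΩ hb
    (differentiable_pullbackForm hα hF)
    (extDeriv_pullbackForm_of_finrank_le (by simp) hα hF) fun r hr x hx =>
      pullbackForm_eventuallyEq_zero hF.continuous.continuousAt fun hmem =>
        disjoint_left.1 (hfr x hx) ?_ (hsupp hmem)
  · simpa [pullbackForm_smul_volForm_cons (hF.differentiable two_ne_zero), lineHomotopy,
      heinzIntegral] using h
  · rw [segment_eq_image]
    exact ⟨r, hr, by simp [lineHomotopy]⟩

end HeinzIntegral

section HomotopyInvariance

theorem heinzIntegral_conj {E F : Type*} [NormedAddCommGroup E] [NormedSpace ℝ E]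
    [MeasureSpace E] [BorelSpace E] [NormedAddCommGroup F] [NormedSpace ℝ F] [MeasureSpace F]
    [BorelSpace F] (e : E ≃L[ℝ] F) (he : MeasurePreserving e) (φ : F → ℝ) (g : F → F)
    (Ω : Set F) :
    heinzIntegral (φ ∘ e) (e.symm ∘ g ∘ e) (e ⁻¹' Ω) = heinzIntegral φ g Ω := by
  have hdet (x : E) : (fderiv ℝ (e.symm ∘ g ∘ e) x).det = (fderiv ℝ g (e x)).det := by
    rw [e.symm.comp_fderiv, e.comp_right_fderiv]
    exact LinearMap.det_conj (fderiv ℝ g (e x) : F →ₗ[ℝ] F) e.symm.toLinearEquiv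
  simp only [heinzIntegral, hdet, Function.comp_apply, e.apply_symm_apply]
  exact he.setIntegral_preimage_emb e.toHomeomorph.measurableEmbedding
    (fun y => φ (g y) * (fderiv ℝ g y).det) Ω

variable {ι : Type*} [Fintype ι] {g k : (ι → ℝ) → ι → ℝ} {Ω : Set (ι → ℝ)}

theorem exists_measurePreserving_equiv_fin (ι : Type*) [Fintype ι] :
    ∃ e : (Fin (Fintype.card ι) → ℝ) ≃L[ℝ] (ι → ℝ), MeasurePreserving e :=
  ⟨ContinuousLinearEquiv.piCongrLeft ℝ (fun _ => ℝ) (Fintype.equivFin ι).symm,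
    volume_measurePreserving_piCongrLeft (fun _ => ℝ) (Fintype.equivFin ι).symm⟩

theorem heinzIntegral_eq_of_homotopy {φ : (ι → ℝ) → ℝ} (hΩ : IsOpen Ω)
    (hb : Bornology.IsBounded Ω) (hg : ContDiff ℝ 2 g) (hk : ContDiff ℝ 2 k)
    (hφ : Differentiable ℝ φ)
    (hfr : ∀ x ∈ frontier Ω, Disjoint (segment ℝ (g x) (k x)) (tsupport φ)) :
    heinzIntegral φ g Ω = heinzIntegral φ k Ω := by
  obtain ⟨e, he⟩ := exists_measurePreserving_equiv_fin ι
  rw [← heinzIntegral_conj e he, ← heinzIntegral_conj e he]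
  refine heinzIntegral_eq_of_homotopy_fin (hΩ.preimage e.continuous)
    (e.antilipschitz.isBounded_preimage hb) (e.symm.contDiff.comp (hg.comp e.contDiff))
    (e.symm.contDiff.comp (hk.comp e.contDiff)) (hφ.comp e.differentiable) fun x hx => ?_
  have hx' : e x ∈ frontier Ω := (e.toHomeomorph.preimage_frontier Ω).symm.subset hx
  refine disjoint_left.2 fun y hy hys => disjoint_left.1 (hfr _ hx') ?_
    (tsupport_comp_subset_preimage φ e.continuous hys)
  simpa using (image_segment ℝ (e : (Fin _ → ℝ) →ₗ[ℝ] (ι → ℝ)).toAffineMap _ _).subset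
    (mem_image_of_mem _ hy)

theorem isCompact_iUnion_segment {X E : Type*} [TopologicalSpace X] [AddCommGroup E] [Module ℝ E]
    [TopologicalSpace E] [IsTopologicalAddGroup E] [ContinuousSMul ℝ E] {g k : X → E} {K : Set X}
    (hK : IsCompact K) (hg : Continuous g) (hk : Continuous k) :
    IsCompact (⋃ x ∈ K, segment ℝ (g x) (k x)) := by
  have h : (⋃ x ∈ K, segment ℝ (g x) (k x)) =
      (fun z : X × ℝ => (1 - z.2) • g z.1 + z.2 • k z.1) '' K ×ˢ Icc 0 1 := by
    ext y
    simp [segment_eq_image, and_assoc]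
  rw [h]
  exact (hK.prod isCompact_Icc).image (by fun_prop)

theorem eventually_heinzIntegral_eq {p : ι → ℝ} (hΩ : IsOpen Ω) (hb : Bornology.IsBounded Ω)
    (hg : ContDiff ℝ 2 g) (hk : ContDiff ℝ 2 k)
    (hp : ∀ x ∈ frontier Ω, p ∉ segment ℝ (g x) (k x)) :
    ∀ᶠ W in (𝓝 p).smallSets, ∀ φ : (ι → ℝ) → ℝ, Differentiable ℝ φ → tsupport φ ⊆ W →
      heinzIntegral φ g Ω = heinzIntegral φ k Ω := by
  have hcompact := isCompact_iUnion_segment (isCompact_of_isClosed_isBounded isClosed_frontier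
    (hb.closure.subset frontier_subset_closure)) hg.continuous hk.continuous
  have hnhds := hcompact.isClosed.isOpen_compl.mem_nhds
    (show p ∉ ⋃ x ∈ frontier Ω, segment ℝ (g x) (k x) by simpa using hp)
  filter_upwards [eventually_smallSets_subset.2 hnhds] with W hW φ hφ hφW
  refine heinzIntegral_eq_of_homotopy hΩ hb hg hk hφ fun x hx => disjoint_left.2 fun y hy hys => ?_
  exact hW (hφW hys) (mem_iUnion₂_of_mem hx hy)

end HomotopyInvariance

section LocalDegree

variable {ι : Type*} [Fintype ι] {g : (ι → ℝ) → ι → ℝ} {Ω : Set (ι → ℝ)} {p : ι → ℝ}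

/-- `U` is an open neighbourhood of `x` on which `g` is injective with `det Dg` of constant sign:
the neighbourhoods that compute the local degree of `g` at a nondegenerate point `x`. -/
structure IsOrientedChartAt (g : (ι → ℝ) → ι → ℝ) (x : ι → ℝ) (U : Set (ι → ℝ)) : Prop where
  isOpen : IsOpen U
  mem : x ∈ U
  injOn : InjOn g U
  image_mem_nhds : g '' U ∈ 𝓝 (g x)
  sign_eq : ∀ y ∈ U, SignType.sign (fderiv ℝ g y).det = SignType.sign (fderiv ℝ g x).det

theorem continuous_det_fderiv (hg : ContDiff ℝ 1 g) : Continuous fun x => (fderiv ℝ g x).det :=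
  ContinuousLinearMap.continuous_det.comp (hg.continuous_fderiv one_ne_zero)

theorem exists_isOrientedChartAt (hg : ContDiff ℝ 1 g) {x : ι → ℝ} (hx : (fderiv ℝ g x).det ≠ 0)
    {W : Set (ι → ℝ)} (hW : W ∈ 𝓝 x) : ∃ U ⊆ W, IsOrientedChartAt g x U := by
  let L := (fderiv ℝ g x).toContinuousLinearEquivOfDetNeZero hx
  have hL : HasStrictFDerivAt g (L : (ι → ℝ) →L[ℝ] ι → ℝ) x := by
    rw [ContinuousLinearMap.coe_toContinuousLinearEquivOfDetNeZero]
    exact hg.contDiffAt.hasStrictFDerivAt one_ne_zero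
  let P := hL.toOpenPartialHomeomorph g
  have hsign : ∀ᶠ y in 𝓝 x,
      SignType.sign (fderiv ℝ g y).det = SignType.sign (fderiv ℝ g x).det :=
    (ContinuousAt.comp (f := fun y => (fderiv ℝ g y).det) (continuousAt_sign_of_ne_zero hx)
      (continuous_det_fderiv hg).continuousAt).eventually_mem
        ((isOpen_discrete _).mem_nhds (mem_singleton _))
  obtain ⟨U, hU, hUo, hxU⟩ := _root_.mem_nhds_iff.1 <| inter_mem
    (inter_mem (P.open_source.mem_nhds hL.mem_toOpenPartialHomeomorph_source) hW) hsign
  refine ⟨U, fun y hy => (hU hy).1.2, hUo, hxU, fun y hy z hz h => ?_, ?_, fun y hy => (hU hy).2⟩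
  · exact P.injOn (hU hy).1.1 (hU hz).1.1 h
  · rw [← hL.map_nhds_eq_of_equiv]
    exact image_mem_map (hUo.mem_nhds hxU)

theorem IsOrientedChartAt.heinzIntegral_eq {x : ι → ℝ} {U : Set (ι → ℝ)} {φ : (ι → ℝ) → ℝ}
    (hU : IsOrientedChartAt g x U) (hg : Differentiable ℝ g)
    (hφ : Function.support φ ⊆ g '' U) :
    heinzIntegral φ g U = (SignType.sign (fderiv ℝ g x).det : ℤ) * ∫ y, φ y := by
  have habs (y) (hy : y ∈ U) : (SignType.sign (fderiv ℝ g x).det : ℤ) *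
      (|(fderiv ℝ g y).det| * φ (g y)) = φ (g y) * (fderiv ℝ g y).det := by
    rw [← hU.sign_eq y hy, ← mul_assoc, mul_comm]
    simp
  rw [← setIntegral_eq_integral_of_forall_compl_eq_zero (s := g '' U)
      fun y hy => notMem_support.1 fun h => hy (hφ h),
    integral_image_eq_integral_abs_det_fderiv_smul volume hU.isOpen.measurableSet
      (fun y _ => (hg y).hasFDerivAt.hasFDerivWithinAt) hU.injOn, ← integral_const_mul]
  exact (setIntegral_congr_fun hU.isOpen.measurableSet habs).symm

theorem closure_inter_preimage_singleton {X Y : Type*} [TopologicalSpace X] {f : X → Y}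
    {U : Set X} {y : Y} (hfr : ∀ x ∈ frontier U, f x ≠ y) :
    closure U ∩ f ⁻¹' {y} = {x | x ∈ U ∧ f x = y} := by
  ext x
  refine ⟨fun h => ⟨?_, h.2⟩, fun h => ⟨subset_closure h.1, h.2⟩⟩
  by_contra hx
  exact hfr x ⟨h.1, fun hi => hx (interior_subset hi)⟩ h.2

theorem IsRegularValueOn.finite_fiber (hp : IsRegularValueOn g Ω p) (hg : ContDiff ℝ 1 g)
    (hb : Bornology.IsBounded Ω) (hfr : ∀ x ∈ frontier Ω, g x ≠ p) :
    {x | x ∈ Ω ∧ g x = p}.Finite := by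
  have hcompact : IsCompact {x | x ∈ Ω ∧ g x = p} := closure_inter_preimage_singleton hfr ▸
    hb.isCompact_closure.inter_right (isClosed_singleton.preimage hg.continuous)
  refine hcompact.finite <| isDiscrete_iff_forall_mem_exists_isOpen.2 fun x hx => ?_
  obtain ⟨U, -, hU⟩ := exists_isOrientedChartAt hg (hp x hx.1 hx.2) univ_mem
  refine ⟨U, hU.isOpen, subset_antisymm (fun y hy => ?_) (by simp [hU.mem, hx.1, hx.2])⟩
  exact hU.injOn hy.1 hU.mem (hy.2.2.trans hx.2.symm)

theorem exists_pairwiseDisjoint_isOrientedChartAt {Z : Set (ι → ℝ)} (hZ : Z.Finite)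
    (hg : ContDiff ℝ 1 g) (hdet : ∀ x ∈ Z, (fderiv ℝ g x).det ≠ 0) (hΩ : IsOpen Ω) (hZΩ : Z ⊆ Ω) :
    ∃ U : (ι → ℝ) → Set (ι → ℝ),
      (∀ x ∈ Z, U x ⊆ Ω ∧ IsOrientedChartAt g x (U x)) ∧ Z.PairwiseDisjoint U := by
  obtain ⟨S, hS, hdisj⟩ := hZ.t2_separation
  choose! U hUS hU using fun x (hx : x ∈ Z) => exists_isOrientedChartAt hg (hdet x hx)
    (inter_mem (hΩ.mem_nhds (hZΩ hx)) ((hS x).2.mem_nhds (hS x).1))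
  exact ⟨U, fun x hx => ⟨(hUS x hx).trans inter_subset_left, hU x hx⟩, fun x hx y hy hxy =>
    (hdisj hx hy hxy).mono ((hUS x hx).trans inter_subset_right)
      ((hUS y hy).trans inter_subset_right)⟩

theorem eventually_inter_preimage_subset {X Y : Type*} [TopologicalSpace X] [TopologicalSpace Y]
    [T2Space Y] {f : X → Y} {K O : Set X} {y : Y} (hf : Continuous f) (hK : IsCompact K)
    (hO : IsOpen O) (hfiber : K ∩ f ⁻¹' {y} ⊆ O) :
    ∀ᶠ W in (𝓝 y).smallSets, K ∩ f ⁻¹' W ⊆ O := by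
  have hy : y ∉ f '' (K \ O) := fun ⟨x, hx, hxy⟩ => hx.2 (hfiber ⟨hx.1, hxy⟩)
  filter_upwards [eventually_smallSets_subset.2
    (((hK.diff hO).image hf).isClosed.isOpen_compl.mem_nhds hy)] with W hW x hx
  by_contra hxO
  exact hW hx.2 ⟨x, ⟨hx.1, hxO⟩, rfl⟩

theorem heinzIntegral_eq_sum {φ : (ι → ℝ) → ℝ} {κ : Type*} {s : Finset κ} {U : κ → Set (ι → ℝ)}
    (hg : ContDiff ℝ 1 g) (hφ : Continuous φ) (hΩ : MeasurableSet Ω) (hb : Bornology.IsBounded Ω)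
    (hU : ∀ i ∈ s, MeasurableSet (U i)) (hUΩ : ∀ i ∈ s, U i ⊆ Ω)
    (hdisj : (s : Set κ).PairwiseDisjoint U)
    (hcover : Ω ∩ g ⁻¹' Function.support φ ⊆ ⋃ i ∈ s, U i) :
    heinzIntegral φ g Ω = ∑ i ∈ s, heinzIntegral φ g (U i) := by
  have hint : IntegrableOn (fun x => φ (g x) * (fderiv ℝ g x).det) (closure Ω) :=
    ((hφ.comp hg.continuous).mul (continuous_det_fderiv hg)).continuousOn.integrableOn_compact
      hb.isCompact_closure
  rw [heinzIntegral, setIntegral_eq_of_subset_of_forall_sdiff_eq_zero hΩ (iUnion₂_subset hUΩ)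
    fun x hx => ?_]
  · exact integral_biUnion_finset s hU hdisj fun i hi =>
      hint.mono_set ((hUΩ i hi).trans subset_closure)
  · rw [notMem_support.1 fun h => hx.2 (hcover ⟨hx.1, h⟩), zero_mul]

theorem eventually_heinzIntegral_eq_signedCount_mul (hg : ContDiff ℝ 1 g) (hΩ : IsOpen Ω)
    (hb : Bornology.IsBounded Ω) (hfr : ∀ x ∈ frontier Ω, g x ≠ p) (hp : IsRegularValueOn g Ω p) :
    ∀ᶠ W in (𝓝 p).smallSets, ∀ φ : (ι → ℝ) → ℝ, Continuous φ → Function.support φ ⊆ W →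
      heinzIntegral φ g Ω = signedCount g Ω p * ∫ y, φ y := by
  have hfin := hp.finite_fiber hg hb hfr
  obtain ⟨U, hU, hdisj⟩ := exists_pairwiseDisjoint_isOrientedChartAt hfin hg
    (fun x hx => hp x hx.1 hx.2) hΩ fun x hx => hx.1
  have himage : (⋂ x ∈ {x | x ∈ Ω ∧ g x = p}, g '' U x) ∈ 𝓝 p :=
    (biInter_mem hfin).2 fun x hx => hx.2 ▸ (hU x hx).2.image_mem_nhds
  have hfiber : closure Ω ∩ g ⁻¹' {p} ⊆ ⋃ x ∈ {x | x ∈ Ω ∧ g x = p}, U x := by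
    rw [closure_inter_preimage_singleton hfr]
    exact fun x hx => mem_iUnion₂_of_mem hx (hU x hx).2.mem
  filter_upwards [eventually_smallSets_subset.2 himage, eventually_inter_preimage_subset
    hg.continuous hb.isCompact_closure (isOpen_biUnion fun x hx => (hU x hx).2.isOpen) hfiber]
    with W hWimage hWcover φ hφ hφW
  rw [heinzIntegral_eq_sum (s := hfin.toFinset) (U := U) hg hφ hΩ.measurableSet hb, signedCount,
    finsum_mem_eq_finite_toFinset_sum _ hfin, Int.cast_sum, Finset.sum_mul]
  · refine Finset.sum_congr rfl fun x hx => ?_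
    rw [hfin.mem_toFinset] at hx
    exact (hU x hx).2.heinzIntegral_eq (hg.differentiable one_ne_zero)
      (hφW.trans (hWimage.trans (biInter_subset_of_mem hx)))
  · exact fun x hx => (hU x (hfin.mem_toFinset.1 hx)).2.isOpen.measurableSet
  · exact fun x hx => (hU x (hfin.mem_toFinset.1 hx)).1
  · rwa [hfin.coe_toFinset]
  · simpa using (inter_subset_inter subset_closure (preimage_mono hφW)).trans hWcover

end LocalDegree

section VanishingDegree

variable {ι : Type*} [Fintype ι] {f g : (ι → ℝ) → ι → ℝ} {Ω : Set (ι → ℝ)} {p : ι → ℝ}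

theorem ae_isRegularValueOn (hf : Differentiable ℝ f) (Ω : Set (ι → ℝ)) :
    ∀ᵐ q, IsRegularValueOn f Ω q := by
  refine measure_mono_null (t := f '' {x | (fderiv ℝ f x).det = 0}) (fun q hq => ?_) <|
    addHaar_image_eq_zero_of_det_fderivWithin_eq_zero volume
      (fun x _ => (hf x).hasFDerivAt.hasFDerivWithinAt) fun x hx => hx
  obtain ⟨x, -, hxq, hdet⟩ : ∃ x ∈ Ω, f x = q ∧ (fderiv ℝ f x).det = 0 := by
    simpa [IsRegularValueOn] using hq
  exact ⟨x, hdet, hxq⟩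

theorem exists_isRegularApprox (hf : ContDiff ℝ ∞ f) (hb : Bornology.IsBounded Ω)
    (hp : p ∉ f '' frontier Ω) : ∃ g, IsRegularApprox f Ω p g := by
  have hcompact : IsCompact (f '' frontier Ω) := (isCompact_of_isClosed_isBounded isClosed_frontier
    (hb.closure.subset frontier_subset_closure)).image hf.continuous
  obtain ⟨δ, hδ, hball⟩ := nhds_basis_ball.mem_iff.1 (hcompact.isClosed.isOpen_compl.mem_nhds hp)
  obtain ⟨q, hq, hpq⟩ := (Measure.dense_of_ae
    (ae_isRegularValueOn (hf.differentiable (by simp)) Ω)).exists_dist_lt p hδ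
  refine ⟨fun x => f x + (p - q), hf.add contDiff_const, fun x _ y hy => ?_, fun x hx hxp => ?_⟩
  · have hfar : δ ≤ dist p (f y) :=
      not_lt.1 fun h => hball (mem_ball'.2 h) (mem_image_of_mem f hy)
    simpa [dist_eq_norm] using hpq.trans_le hfar
  · rw [fderiv_add_const]
    exact hq x hx (by rwa [add_sub_left_comm, add_eq_left, sub_eq_zero] at hxp)

theorem IsRegularApprox.notMem_segment (hg : IsRegularApprox f Ω p g) {x : ι → ℝ}
    (hx : x ∈ frontier Ω) : p ∉ segment ℝ (g x) (f x) := fun hp =>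
  (hg.close x (frontier_subset_closure hx) x hx).not_ge <| mem_closedBall.1 <|
    (convex_closedBall (f x) (dist (g x) (f x))).segment_subset (mem_closedBall.2 le_rfl)
      (mem_closedBall_self dist_nonneg) hp

theorem exists_forall_notMem_segment {E : Type*} [AddCommGroup E] [Module ℝ E] {s : Set E} {p : E}
    (hp : p ∉ convexHull ℝ s) : ∃ v, ∀ y ∈ s, p ∉ segment ℝ y v := by
  obtain rfl | ⟨v, hv⟩ := s.eq_empty_or_nonempty
  · simp
  · exact ⟨v, fun y hy h => hp (segment_subset_convexHull hy hv h)⟩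

theorem heinzIntegral_const [Nonempty ι] (φ : (ι → ℝ) → ℝ) (v : ι → ℝ) (Ω : Set (ι → ℝ)) :
    heinzIntegral φ (fun _ => v) Ω = 0 := by
  simp [heinzIntegral, ContinuousLinearMap.det]

theorem exists_contDiff_tsupport_subset_integral_pos {W : Set (ι → ℝ)} (hW : W ∈ 𝓝 p) :
    ∃ φ : (ι → ℝ) → ℝ, ContDiff ℝ 1 φ ∧ tsupport φ ⊆ W ∧ 0 < ∫ y, φ y := by
  obtain ⟨φ, hφW, hφc, hφ, hφr, hφp⟩ := exists_contDiff_tsupport_subset (n := 1) hW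
  refine ⟨φ, hφ, hφW, hφ.continuous.integral_pos_of_hasCompactSupport_nonneg_nonzero hφc
    (fun y => (hφr (mem_range_self y)).1) (x := p) ?_⟩
  simp [hφp]

theorem IsRegularApprox.signedCount_eq_zero [Nonempty ι] (hg : IsRegularApprox f Ω p g)
    (hf : ContDiff ℝ 2 f) (hΩ : IsOpen Ω) (hb : Bornology.IsBounded Ω)
    (hp : p ∉ convexHull ℝ (f '' frontier Ω)) : signedCount g Ω p = 0 := by
  have hg2 : ContDiff ℝ 2 g := contDiff_infty.1 hg.smooth 2
  obtain ⟨v, hv⟩ := exists_forall_notMem_segment hp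
  have hgf := eventually_heinzIntegral_eq hΩ hb hg2 hf fun x hx => hg.notMem_segment hx
  have hfv := eventually_heinzIntegral_eq hΩ hb hf contDiff_const
    fun x hx => hv _ (mem_image_of_mem f hx)
  have hcount := eventually_heinzIntegral_eq_signedCount_mul (hg2.of_le one_le_two) hΩ hb
    (fun x hx h => hg.notMem_segment hx (h ▸ left_mem_segment ℝ _ _)) hg.regular
  obtain ⟨W, hW, hWφ⟩ := eventually_smallSets.1 (hgf.and (hfv.and hcount))
  obtain ⟨hgf, hfv, hcount⟩ := hWφ W subset_rfl
  obtain ⟨φ, hφ, hφW, hpos⟩ := exists_contDiff_tsupport_subset_integral_pos hW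
  have hφd : Differentiable ℝ φ := hφ.differentiable one_ne_zero
  have h0 : (signedCount g Ω p : ℝ) * ∫ y, φ y = 0 := calc
    _ = heinzIntegral φ g Ω := (hcount φ hφ.continuous ((subset_tsupport φ).trans hφW)).symm
    _ = heinzIntegral φ f Ω := hgf φ hφd hφW
    _ = heinzIntegral φ (fun _ => v) Ω := hfv φ hφd hφW
    _ = 0 := heinzIntegral_const φ v Ω
  exact_mod_cast (mul_eq_zero.1 h0).resolve_right hpos.ne'

theorem hasBrouwerDegree_zero_of_notMem_convexHull [Nonempty ι] (hf : ContDiff ℝ ∞ f)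
    (hΩ : IsOpen Ω) (hb : Bornology.IsBounded Ω) (hp : p ∉ convexHull ℝ (f '' frontier Ω)) :
    HasBrouwerDegree f Ω p 0 where
  isOpen := hΩ
  isBounded := hb
  continuousOn := hf.continuous.continuousOn
  notMem h := hp (subset_convexHull ℝ _ h)
  exists_approx := exists_isRegularApprox hf hb fun h => hp (subset_convexHull ℝ _ h)
  count_eq _ hg := hg.signedCount_eq_zero (contDiff_infty.1 hf 2) hΩ hb hp

end VanishingDegree

section Tzitzeica

theorem neg_quarter_le_exp_mul_exp_sub_one (t : ℝ) :
    -(1 / 4) ≤ Real.exp t * (Real.exp t - 1) := by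
  nlinarith [sq_nonneg (Real.exp t - 1 / 2)]

theorem le_exp_mul_exp_sub_one (t : ℝ) : t ≤ Real.exp t * (Real.exp t - 1) := by
  nlinarith [Real.add_one_le_exp t, sq_nonneg (Real.exp t - 1)]

theorem min_mul_abs_sub_le_exp_add_exp {a b A B s : ℝ} (ha : 0 ≤ a) (hb : 0 ≤ b) :
    min (a * A) (b * B) * |s| - (a + b) / 4 ≤
      a * Real.exp (A * s) * (Real.exp (A * s) - 1) +
        b * Real.exp (-B * s) * (Real.exp (-B * s) - 1) := by
  have ha4 := mul_le_mul_of_nonneg_left (neg_quarter_le_exp_mul_exp_sub_one (A * s)) ha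
  have hb4 := mul_le_mul_of_nonneg_left (neg_quarter_le_exp_mul_exp_sub_one (-B * s)) hb
  rcases le_total 0 s with hs | hs
  · have hmin := mul_le_mul_of_nonneg_right (min_le_left (a * A) (b * B)) hs
    have hlin := mul_le_mul_of_nonneg_left (le_exp_mul_exp_sub_one (A * s)) ha
    rw [abs_of_nonneg hs]
    linarith
  · have hmin := mul_le_mul_of_nonneg_right (min_le_right (a * A) (b * B)) (neg_nonneg.2 hs)
    have hlin := mul_le_mul_of_nonneg_left (le_exp_mul_exp_sub_one (-B * s)) hb
    rw [abs_of_nonpos hs]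
    linarith

variable {V : Type*} [Fintype V]

theorem exists_forall_mul_norm_le_sum_mul_abs [Nonempty V] {a : V → ℝ} (ha : ∀ x, 0 < a x) :
    ∃ m > 0, ∀ u : V → ℝ, m * ‖u‖ ≤ ∑ x, a x * |u x| := by
  obtain ⟨x₀, hx₀⟩ := Finite.exists_min a
  refine ⟨a x₀, ha x₀, fun u => ?_⟩
  rw [← le_div_iff₀' (ha x₀)]
  refine (pi_norm_le_iff_of_nonempty u).2 fun x => ?_
  rw [le_div_iff₀' (ha x₀)]
  calc a x₀ * |u x| ≤ a x * |u x| := by gcongr; exact hx₀ x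
    _ ≤ ∑ x, a x * |u x| := Finset.single_le_sum (f := fun x => a x * |u x|)
        (fun y _ => mul_nonneg (ha y).le (abs_nonneg _)) (Finset.mem_univ x)

variable (G : SimpleGraph V) [DecidableRel G.Adj] {μ : V → ℝ} {w : V → V → ℝ} {h₁ h₂ : V → ℝ}
  {A B : ℝ}

theorem sum_mul_graphLaplacian (hμ : ∀ x, μ x ≠ 0) (hw : ∀ x y, G.Adj x y → w x y = w y x)
    (u : V → ℝ) : ∑ x, μ x * graphLaplacian G μ w u x = 0 := by
  have hcancel (x : V) : μ x * graphLaplacian G μ w u x =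
      ∑ y ∈ G.neighborFinset x, w x y * (u y - u x) := by
    rw [graphLaplacian, ← mul_assoc, mul_one_div_cancel (hμ x), one_mul]
  have hantisymm : ∑ x, ∑ y ∈ G.neighborFinset x, w x y * (u y - u x) =
      -∑ x, ∑ y ∈ G.neighborFinset x, w x y * (u y - u x) := by
    conv_lhs =>
      rw [Finset.sum_comm' (t' := Finset.univ) (s' := fun y => G.neighborFinset y)
        (by simp [SimpleGraph.adj_comm])]
    simp only [← Finset.sum_neg_distrib]
    refine Finset.sum_congr rfl fun x _ => Finset.sum_congr rfl fun y hy => ?_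
    rw [hw y x ((G.mem_neighborFinset x y).1 hy).symm]
    ring
  simp only [hcancel]
  linarith

theorem contDiff_tzitzeicaMap : ContDiff ℝ ∞ (tzitzeicaMap G μ w h₁ h₂ A B) := by
  unfold tzitzeicaMap graphLaplacian
  fun_prop

theorem sum_mul_tzitzeicaMap (hμ : ∀ x, μ x ≠ 0) (hw : ∀ x y, G.Adj x y → w x y = w y x)
    (u : V → ℝ) : ∑ x, μ x * tzitzeicaMap G μ w h₁ h₂ A B u x =
      ∑ x, μ x * (h₁ x * Real.exp (A * u x) * (Real.exp (A * u x) - 1) +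
        h₂ x * Real.exp (-B * u x) * (Real.exp (-B * u x) - 1)) := by
  rw [← add_zero (∑ x, μ x * tzitzeicaMap G μ w h₁ h₂ A B u x),
    ← sum_mul_graphLaplacian G hμ hw u, ← Finset.sum_add_distrib]
  refine Finset.sum_congr rfl fun x _ => ?_
  rw [tzitzeicaMap]
  ring

theorem exists_mul_norm_sub_le_sum_mul_tzitzeicaMap [Nonempty V] (hμ : ∀ x, 0 < μ x)
    (hw : ∀ x y, G.Adj x y → w x y = w y x) (hh₁ : ∀ x, 0 < h₁ x) (hh₂ : ∀ x, 0 < h₂ x)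
    (hA : 0 < A) (hB : 0 < B) :
    ∃ m > 0, ∃ D ≥ 0, ∀ u : V → ℝ,
      m * ‖u‖ - D ≤ ∑ x, μ x * tzitzeicaMap G μ w h₁ h₂ A B u x := by
  obtain ⟨m, hm, hmu⟩ := exists_forall_mul_norm_le_sum_mul_abs
    (a := fun x => μ x * min (h₁ x * A) (h₂ x * B))
    fun x => mul_pos (hμ x) (lt_min (mul_pos (hh₁ x) hA) (mul_pos (hh₂ x) hB))
  refine ⟨m, hm, ∑ x, μ x * ((h₁ x + h₂ x) / 4), Finset.sum_nonneg fun x _ =>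
    mul_nonneg (hμ x).le (div_nonneg (add_pos (hh₁ x) (hh₂ x)).le zero_le_four), fun u => ?_⟩
  rw [sum_mul_tzitzeicaMap G (fun x => (hμ x).ne') hw, sub_le_iff_le_add]
  calc m * ‖u‖ ≤ ∑ x, μ x * min (h₁ x * A) (h₂ x * B) * |u x| := hmu u
    _ ≤ _ := by
      rw [← Finset.sum_add_distrib]
      refine Finset.sum_le_sum fun x _ => ?_
      rw [mul_assoc, ← mul_add]
      exact mul_le_mul_of_nonneg_left
        (sub_le_iff_le_add.1 (min_mul_abs_sub_le_exp_add_exp (hh₁ x).le (hh₂ x).le)) (hμ x).le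

theorem zero_notMem_convexHull_of_sum_mul_pos {s : Set (V → ℝ)}
    (hs : ∀ v ∈ s, 0 < ∑ x, μ x * v x) : (0 : V → ℝ) ∉ convexHull ℝ s := by
  have hlin : IsLinearMap ℝ fun v : V → ℝ => ∑ x, μ x * v x :=
    ⟨fun v v' => by simp [mul_add, Finset.sum_add_distrib],
      fun c v => by simp [Finset.mul_sum, mul_left_comm]⟩
  intro h
  have h0 : 0 < ∑ x, μ x * (0 : V → ℝ) x := convexHull_min hs (convex_halfSpace_gt hlin 0) h
  simp at h0

theorem theorem2_general [Nonempty V] (hμ : ∀ x, 0 < μ x)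
    (hw_symm : ∀ x y, G.Adj x y → w x y = w y x) (hh₁ : ∀ x, 0 < h₁ x) (hh₂ : ∀ x, 0 < h₂ x)
    (hA : 0 < A) (hB : 0 < B) :
    ∃ L : ℝ, ∀ R : ℝ, L < R →
      HasBrouwerDegree (tzitzeicaMap G μ w h₁ h₂ A B) (ball (0 : V → ℝ) R) 0 0 := by
  obtain ⟨m, hm, D, hD, hcoercive⟩ :=
    exists_mul_norm_sub_le_sum_mul_tzitzeicaMap G hμ hw_symm hh₁ hh₂ hA hB
  refine ⟨D / m, fun R hR => hasBrouwerDegree_zero_of_notMem_convexHull (contDiff_tzitzeicaMap G)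
    isOpen_ball isBounded_ball (zero_notMem_convexHull_of_sum_mul_pos (μ := μ) ?_)⟩
  rw [frontier_ball _ ((div_nonneg hD hm.le).trans_lt hR).ne', forall_mem_image]
  intro u hu
  rw [mem_sphere_zero_iff_norm] at hu
  refine (sub_pos.2 ?_).trans_le (hcoercive u)
  rwa [hu, ← div_lt_iff₀' hm]

end Tzitzeica

end

theorem theorem2 {V : Type*} [Fintype V] (G : SimpleGraph V) [DecidableRel G.Adj]
    (hG : G.Connected)
    (μ : V → ℝ) (hμ : ∀ x, 0 < μ x)
    (w : V → V → ℝ) (hw_pos : ∀ x y, G.Adj x y → 0 < w x y)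
    (hw_symm : ∀ x y, G.Adj x y → w x y = w y x)
    (h₁ h₂ : V → ℝ) (hh₁ : ∀ x, 0 < h₁ x) (hh₂ : ∀ x, 0 < h₂ x)
    (A B : ℝ) (hA : 0 < A) (hB : 0 < B) :
    ∃ L : ℝ, ∀ R : ℝ, L < R →
      HasBrouwerDegree (tzitzeicaMap G μ w h₁ h₂ A B) (Metric.ball (0 : V → ℝ) R) 0 0 := by
  have := hG.nonempty
  exact theorem2_general G hμ hw_symm hh₁ hh₂ hA hB
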